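/- For integers $k,n,m$, let $B_2^k(r)$ be the closed Euclidean ball of radius $r>0$ in $\mathbb{R}^k$, let $G:B_2^k(r)\to\mathbb{R}^n$ be $L$-Lipschitz with range $\mathcal{R}(G)$, and for $\mathbf{s}\in\mathbb{R}^n$ let $\mathcal{P}_G(\mathbf{s})$ denote a point of $\arg\min_{\mathbf{w}\in\mathcal{R}(G)}\|\mathbf{w}-\mathbf{s}\|_2$ (any minimizer if there are several). Let $f:\mathbb{R}\to\mathbb{R}$ be a random function, let $g\sim\mathcal{N}(0,1)$ be independent of $f$, and put $$\mu=\mathbb{E}[f(g)g],\qquad \xi^2=\mathbb{E}[f(g)^2]\ (\xi\ge 0),\qquad \rho^2=\mathrm{Var}[f(g)g],\qquad \theta^4=\mathrm{Var}[f(g)^2].$$ Assume $\mathbb{E}[f(g)^4]<\infty$ and $\mu\neq 0$. Let $\mathbf{a}_1,\dots,\mathbf{a}_m$ be i.i.d. $\mathcal{N}(\mathbf{0},\mathbf{I}_n)$ vectors, let $\mathbf{A}\in\mathbb{R}^{m\times n}$ be the matrix with rows $\mathbf{a}_i^T$, and let $f_1,\dots,f_m$ be i.i.d. copies of $f$, independent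 of $\mathbf{A}$. Let $\mathbf{x}\in\mathbb{R}^n$ with $\|\mathbf{x}\|_2=1$ be fixed; it is not assumed that $\mu\mathbf{x}\in\mathcal{R}(G)$. Let $\nu\ge 0$ and let the observed vector $\mathbf{y}\in\mathbb{R}^m$, which may depend arbitrarily on $\mathbf{A}$ and on the $f_i$, satisfy almost surely $$\frac{1}{\sqrt m}\sqrt{\sum_{i=1}^m\big(y_i-f_i(\langle\mathbf{a}_i,\mathbf{x}\rangle)\big)^2}\le\nu .$$ Let $\tilde{\mathbf{x}}=\mathcal{P}_G(\mu\mathbf{x})$ and $\hat{\mathbf{x}}=\mathcal{P}_G\big(\tfrac1m\mathbf{A}^T\mathbf{y}\big)$. Then for all constants $c_1,c_2,c_3>0$ there are constants $c,C>0$, depending only on $c_1,c_2,c_3$, such that in every such situation and for every $\delta>0$ with $$Lr\ge c_1\,\delta n,\qquad \delta\le c_2\,\xi\sqrt{\frac{k\log\frac{Lr}{\delta}}{m}},\qquad m\ge c_3\,k\log\frac{Lr}{\delta},$$ with probability at least $$1-e^{-c\,k\log\frac{Lr}{\delta}}-\frac{\theta^4}{m\xi^4}-\frac{\rho^2}{\xi^2k\log\frac{Lr}{\delta}}$$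 it holds that $$\|\hat{\mathbf{x}}-\mu\mathbf{x}\|_2\le C\left(\xi\sqrt{\frac{k\log\frac{Lr}{\delta}}{m}}+\nu+\|\tilde{\mathbf{x}}-\mu\mathbf{x}\|_2\right).$$ -/

import Mathlib

open MeasureTheory ProbabilityTheory
open scoped NNReal ENNReal

noncomputable section

namespace OneShot

/-- The closed Euclidean ball of radius `r` in `ℝᵏ`, centred at the origin. -/
abbrev LatentBall (k : ℕ) (r : ℝ) : Set (EuclideanSpace ℝ (Fin k)) :=
  Metric.closedBall (0 : EuclideanSpace ℝ (Fin k)) r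

/-- `w` is a Euclidean projection of `s` onto the range of the generative model `G`:
it belongs to `argmin {‖w - s‖ : w ∈ range G}`. -/
def IsProj {k n : ℕ} {r : ℝ} (G : LatentBall k r → EuclideanSpace ℝ (Fin n))
    (s w : EuclideanSpace ℝ (Fin n)) : Prop :=
  w ∈ Set.range G ∧ ∀ v ∈ Set.range G, ‖w - s‖ ≤ ‖v - s‖

/-- The vector `(1/m) Aᵀ y = (1/m) ∑ i, y i • a i`, where `A` is the measurement matrix
with rows `a i`. -/
def backProj {m n : ℕ} (a : Fin m → EuclideanSpace ℝ (Fin n)) (y : Fin m → ℝ) :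
    EuclideanSpace ℝ (Fin n) :=
  (1 / (m : ℝ)) • ∑ i, y i • a i

section Nonlinearity

/- A random function `f : ℝ → ℝ` is given by `f = F s`, where `s` is a random element of a
measurable space `S` with law `κ` and `F` is jointly measurable. Its parameters are computed
under the joint law `κ ⊗ N(0,1)` of `f` and an independent standard normal variable `g`. -/
variable {S : Type*} [MeasurableSpace S] (F : S → ℝ → ℝ) (κ : Measure S)

/-- The joint law of the randomness of `f` and of an independent `g ∼ N(0,1)`. -/
def jointLaw : Measure (S × ℝ) := κ.prod (gaussianReal 0 1)

/-- `μ = 𝔼[f(g) g]`. -/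
def meanParam : ℝ := ∫ p, F p.1 p.2 * p.2 ∂(jointLaw κ)

/-- `ξ`, where `ξ² = 𝔼[f(g)²]`. -/
def xi : ℝ := Real.sqrt (∫ p, F p.1 p.2 ^ 2 ∂(jointLaw κ))

/-- `ρ² = Var[f(g) g]`. -/
def rhoSq : ℝ := variance (fun p : S × ℝ => F p.1 p.2 * p.2) (jointLaw κ)

/-- `θ⁴ = Var[f(g)²]`. -/
def thetaFourth : ℝ := variance (fun p : S × ℝ => F p.1 p.2 ^ 2) (jointLaw κ)

end Nonlinearity

end OneShot

end

/-!
Write `l = k log (L r / δ)`, `ε = ξ √(l / m)`, `p = μ x`, and let `b` be the back-projection of the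
observations. The estimate `w` is at least as close to `b` as the point `w₀ = xtilde` of the range,
so `‖w - w₀‖² ≤ 2 ⟪w - w₀, b - w₀⟫` (`norm_sub_le_of_closer`), and it suffices to bound
`⟪w - w₀, b - p⟫` by a multiple of `(ε + ν) (‖w - w₀‖ + δ)`.

A volume argument (`exists_finset_cover_closedBall`) gives a net of the range of `G` of radius
`δ / √n` with `exp (O(l))` points. If `⟪b - p, u⟫ = O(ε + ν)` holds for the unit vectors `u` in the
directions from `w₀` to the net and for the coordinate vectors, then it holds for `w - w₀` up to an
error `O((ε + ν) δ)`; see `exists_test_directions`. Only `exp (O(l))` fixed directions remain.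

For one direction `u`, split `u` into its part along `x` and its part `v` orthogonal to `x`
(`inner_backProj_sub`). Along `x`, the noiseless error is the deviation of the empirical mean of
`f(g) g` from `μ`, and Chebyshev's inequality gives the term with `ρ²`. Along `v`, the Gaussian
variables `⟪aᵢ, v⟫` are independent of the weights `fᵢ(⟪aᵢ, x⟫)`; on the event that the squares of
the weights have mean at most `2 ξ²`, which costs the term with `θ⁴`, the weighted sum is
sub-Gaussian (`lintegral_exp_mul_inner_le`, `pi_real_sum_mul_inner_le`). The observation error is
handled by Cauchy–Schwarz and a chi-square tail bound for `∑ ⟪aᵢ, u⟫²`. The union bound over the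
directions costs `exp (-l)`; see `exists_bad_event`.

The union bound needs `l ≥ 1` and `log n ≤ 2 log (L r / δ)`. Both hold when `log (L r / δ)` exceeds
a constant depending on `c₁`. Otherwise the whole range of `G` has diameter `O(δ) = O(ε)`, and the
bound holds for any two points of the range.
-/

noncomputable section

namespace OneShot

/-! ### Covering numbers and the deterministic error bound -/

section Covering

variable {E : Type*} [NormedAddCommGroup E] [NormedSpace ℝ E] [FiniteDimensional ℝ E]

/-- Volume bound for packings: the balls of radius `η / 2` around `η`-separated points of a ball of
radius `r` are disjoint and contained in the ball of radius `r + η / 2`. -/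
lemma card_mul_pow_le_of_separated {r η : ℝ} (hη : 0 < η) (hr : 0 ≤ r) (s : Finset E)
    (hs : ∀ c ∈ s, ‖c‖ ≤ r) (h : ∀ c ∈ s, ∀ d ∈ s, c ≠ d → η ≤ ‖c - d‖) :
    (s.card : ℝ) * (η / 2) ^ Module.finrank ℝ E ≤ (r + η / 2) ^ Module.finrank ℝ E := by
  borelize E
  let μ : Measure E := Measure.addHaar
  have hη2 : 0 < η / 2 := by positivity
  have hρ : 0 < r + η / 2 := by positivity
  have hdisj : (s : Set E).PairwiseDisjoint (fun c => Metric.ball c (η / 2)) := by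
    intro c hc d hd hcd
    apply Metric.ball_disjoint_ball
    rw [dist_eq_norm]
    linarith [h c hc d hd hcd]
  have hsub : (⋃ c ∈ s, Metric.ball c (η / 2)) ⊆ Metric.ball (0 : E) (r + η / 2) := by
    refine Set.iUnion₂_subset fun c hc => Metric.ball_subset_ball' ?_
    rw [dist_zero_right]
    linarith [hs c hc]
  have hvol : (s.card : ℝ≥0∞) * ENNReal.ofReal ((η / 2) ^ Module.finrank ℝ E) *
        μ (Metric.ball 0 1) ≤
      ENNReal.ofReal ((r + η / 2) ^ Module.finrank ℝ E) * μ (Metric.ball 0 1) := by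
    have := measure_mono (μ := μ) hsub
    rw [measure_biUnion_finset hdisj fun c _ => measurableSet_ball,
      μ.addHaar_ball_of_pos _ hρ] at this
    simpa only [μ.addHaar_ball_of_pos _ hη2, Finset.sum_const, nsmul_eq_mul, mul_assoc] using this
  have hvol' := (ENNReal.mul_le_mul_iff_left (Metric.measure_ball_pos μ _ zero_lt_one).ne'
    measure_ball_lt_top.ne).1 hvol
  have := ENNReal.toReal_le_of_le_ofReal (by positivity) hvol'
  rwa [ENNReal.toReal_mul, ENNReal.toReal_natCast, ENNReal.toReal_ofReal (by positivity)] at this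

/-- A ball of radius `r` has an `η`-net with at most `(3 r / η) ^ dim` elements. -/
lemma exists_finset_cover_closedBall {r η : ℝ} (hη : 0 < η) (hηr : η ≤ r) :
    ∃ N : Finset E, (N.card : ℝ) ≤ (3 * r / η) ^ Module.finrank ℝ E ∧
      (∀ c ∈ N, ‖c‖ ≤ r) ∧ ∀ z : E, ‖z‖ ≤ r → ∃ c ∈ N, ‖z - c‖ ≤ η := by
  have hr : 0 < r := hη.trans_le hηr
  have hcard : ∀ s : Finset E, (∀ c ∈ s, ‖c‖ ≤ r) → (∀ c ∈ s, ∀ d ∈ s, c ≠ d → η ≤ ‖c - d‖) →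
      (s.card : ℝ) ≤ (3 * r / η) ^ Module.finrank ℝ E := by
    intro s hs hsep
    have h1 := card_mul_pow_le_of_separated hη hr.le s hs hsep
    have h2 : (r + η / 2) ^ Module.finrank ℝ E
        ≤ (3 * r / η) ^ Module.finrank ℝ E * (η / 2) ^ Module.finrank ℝ E := by
      rw [← mul_pow]
      refine pow_le_pow_left₀ (by positivity) ?_ _
      have h3 : 3 * r / η * (η / 2) = 3 * r / 2 := by field_simp
      linarith
    exact le_of_mul_le_mul_right (h1.trans h2) (by positivity)
  set A : Set E := Metric.closedBall 0 r
  set η' : ℝ≥0 := ⟨η, hη.le⟩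
  have hsep : ∀ C : Set E, Metric.IsSeparated η' C → ∀ c ∈ C, ∀ d ∈ C, c ≠ d → η ≤ ‖c - d‖ := by
    intro C hC c hc d hd hcd
    have h3 : (η' : ℝ≥0∞) < edist c d := hC hc hd hcd
    rw [edist_nndist, ENNReal.coe_lt_coe] at h3
    rw [← dist_eq_norm, ← coe_nndist]
    exact_mod_cast h3.le
  set M := ⌊(3 * r / η) ^ Module.finrank ℝ E⌋₊
  have hpack : Metric.packingNumber η' A ≤ M := by
    simp only [Metric.packingNumber, iSup_le_iff]
    intro C hCA hC
    by_contra! hlt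
    obtain ⟨t, htC, ht⟩ := Set.exists_subset_encard_eq (Order.add_one_le_of_lt hlt)
    have htfin : t.Finite := Set.finite_of_encard_eq_coe (k := M + 1) (by simpa using ht)
    have h4 := hcard htfin.toFinset
      (fun c hc => by simpa [A] using hCA (htC (htfin.mem_toFinset.1 hc)))
      (fun c hc d hd => hsep C hC c (htC (htfin.mem_toFinset.1 hc)) d
        (htC (htfin.mem_toFinset.1 hd)))
    have h5 : htfin.toFinset.card ≤ M := Nat.le_floor h4
    rw [htfin.encard_eq_coe_toFinset_card] at ht
    have h6 : htfin.toFinset.card = M + 1 := by exact_mod_cast ht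
    omega
  have htop : Metric.packingNumber η' A ≠ ⊤ := (hpack.trans_lt (ENat.natCast_lt_top M)).ne
  have hcov := Metric.isCover_maximalSeparatedSet htop
  have hfin : (Metric.maximalSeparatedSet η' A).Finite := by
    rw [← Set.encard_ne_top_iff, Metric.encard_maximalSeparatedSet htop]
    exact htop
  have hball : ∀ c ∈ hfin.toFinset, ‖c‖ ≤ r := fun c hc => by
    simpa [A] using Metric.maximalSeparatedSet_subset (hfin.mem_toFinset.1 hc)
  refine ⟨hfin.toFinset, hcard _ hball fun c hc d hd => hsep _
    Metric.isSeparated_maximalSeparatedSet c (hfin.mem_toFinset.1 hc) d (hfin.mem_toFinset.1 hd),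
    hball, fun z hz => ?_⟩
  obtain ⟨c, hc, hzc⟩ := hcov (show z ∈ A by simpa [A] using hz)
  refine ⟨c, hfin.mem_toFinset.2 hc, ?_⟩
  have hzc' : edist z c ≤ η' := hzc
  rw [edist_nndist, ENNReal.coe_le_coe] at hzc'
  rw [← dist_eq_norm, ← coe_nndist]
  exact_mod_cast hzc'

end Covering

/-- The range of an `L`-Lipschitz map on a ball of radius `r` has an `η`-net with at most
`(3 L r / η) ^ k` elements. -/
lemma exists_finset_cover_range {k n : ℕ} {r : ℝ} {L : ℝ≥0}
    {G : LatentBall k r → EuclideanSpace ℝ (Fin n)} (hG : LipschitzWith L G) {η : ℝ}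
    (hη : 0 < η) (hηr : η ≤ L * r) :
    ∃ N : Finset (EuclideanSpace ℝ (Fin n)), (N.card : ℝ) ≤ (3 * (L * r) / η) ^ k ∧
      ∀ w ∈ Set.range G, ∃ v ∈ N, ‖w - v‖ ≤ η := by
  classical
  have hL : 0 < (L : ℝ) := by
    rcases L.2.eq_or_lt with h | h
    · have : (L : ℝ) = 0 := h.symm
      rw [this] at hηr
      linarith
    · exact h
  obtain ⟨N, hcard, hN, hcov⟩ := exists_finset_cover_closedBall
    (E := EuclideanSpace ℝ (Fin k)) (r := r) (η := η / L) (by positivity)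
    (by rw [div_le_iff₀ hL]; linarith)
  refine ⟨N.attach.image fun c => G ⟨c.1, by simpa using hN c.1 c.2⟩, ?_, ?_⟩
  · have h1 : ((N.attach.image fun c => G ⟨c.1, by simpa using hN c.1 c.2⟩).card : ℝ) ≤ N.card := by
      exact_mod_cast Finset.card_image_le.trans (by simp)
    refine h1.trans (hcard.trans (le_of_eq ?_))
    rw [finrank_euclideanSpace_fin]
    congr 1
    field_simp
  · rintro _ ⟨z, rfl⟩
    obtain ⟨c, hc, hzc⟩ := hcov z.1 (mem_closedBall_zero_iff.1 z.2)
    refine ⟨G ⟨c, by simpa using hN c hc⟩, Finset.mem_image.2 ⟨⟨c, hc⟩, by simp, rfl⟩, ?_⟩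
    have h := hG.dist_le_mul z ⟨c, by simpa using hN c hc⟩
    rw [Subtype.dist_eq, dist_eq_norm, dist_eq_norm (z : EuclideanSpace ℝ (Fin k))] at h
    calc _ ≤ _ := h
      _ ≤ L * (η / L) := by gcongr
      _ = η := by field_simp

lemma norm_sub_le_of_mem_range {k n : ℕ} {r : ℝ} {L : ℝ≥0}
    {G : LatentBall k r → EuclideanSpace ℝ (Fin n)} (hG : LipschitzWith L G)
    {v w : EuclideanSpace ℝ (Fin n)} (hv : v ∈ Set.range G) (hw : w ∈ Set.range G) :
    ‖v - w‖ ≤ 2 * (L * r) := by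
  obtain ⟨z, rfl⟩ := hv
  obtain ⟨z', rfl⟩ := hw
  have h := hG.dist_le_mul z z'
  have hz : ‖(z : EuclideanSpace ℝ (Fin k))‖ ≤ r := mem_closedBall_zero_iff.1 z.2
  have hz' : ‖(z' : EuclideanSpace ℝ (Fin k))‖ ≤ r := mem_closedBall_zero_iff.1 z'.2
  rw [dist_eq_norm, Subtype.dist_eq, dist_eq_norm] at h
  calc _ ≤ _ := h
    _ ≤ L * (r + r) := by
      gcongr
      exact (norm_sub_le _ _).trans (add_le_add hz hz')
    _ = _ := by ring

lemma norm_le_sqrt_mul_of_abs_apply_le {n : ℕ} {z : EuclideanSpace ℝ (Fin n)} {B : ℝ}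
    (hB : 0 ≤ B) (h : ∀ i, |z i| ≤ B) : ‖z‖ ≤ Real.sqrt n * B := by
  rw [EuclideanSpace.norm_eq]
  refine Real.sqrt_le_iff.2 ⟨by positivity, ?_⟩
  rw [mul_pow, Real.sq_sqrt (by positivity)]
  calc ∑ i, ‖z i‖ ^ 2 ≤ ∑ _i : Fin n, B ^ 2 := by
        gcongr with i
        exact h i
    _ = n * B ^ 2 := by simp

/-- If `w` is at least as close to `b` as `w₀` is, then `‖w - w₀‖² ≤ 2 ⟪w - w₀, b - w₀⟫`. Splitting
`b - w₀ = (b - p) + (p - w₀)`, the error `‖w - p‖` is controlled by `‖w₀ - p‖` and by the inner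
product of `b - p` with a point `v - w₀` approximating `w - w₀`. -/
lemma norm_sub_le_of_closer {E : Type*} [NormedAddCommGroup E] [InnerProductSpace ℝ E]
    {w w₀ v b p : E} {η δ B D : ℝ} (hB : 0 ≤ B) (hδ : 0 ≤ δ) (hD : ‖b - p‖ ≤ D)
    (hproj : ‖w - b‖ ≤ ‖w₀ - b‖) (hv : ‖w - v‖ ≤ η) (hη : η ≤ δ) (hDη : D * η ≤ B * δ)
    (hinner : inner ℝ (b - p) (v - w₀) ≤ B * ‖v - w₀‖) :
    ‖w - p‖ ≤ 3 * B + 4 * δ + 3 * ‖w₀ - p‖ := by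
  set d := w - w₀
  set τ := ‖w₀ - p‖
  have hτ : 0 ≤ τ := norm_nonneg _
  have h1 : ‖d‖ ^ 2 ≤ 2 * inner ℝ (b - p) d + 2 * inner ℝ (p - w₀) d := by
    have h2 : ‖w - b‖ ^ 2 ≤ ‖w₀ - b‖ ^ 2 := by gcongr
    have h3 : w - b = d + (w₀ - b) := by simp [d]
    rw [h3, norm_add_sq_real] at h2
    have h4 : inner ℝ d (w₀ - b) = -(inner ℝ (b - p) d + inner ℝ (p - w₀) d) := by
      rw [← inner_add_left, real_inner_comm, ← inner_neg_left]
      congr 1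
      abel
    linarith
  have h2 : inner ℝ (p - w₀) d ≤ τ * ‖d‖ := by
    refine (real_inner_le_norm _ _).trans ?_
    rw [norm_sub_rev p w₀]
  have h3 : inner ℝ (b - p) d ≤ B * (‖d‖ + 2 * δ) := by
    have h4 : d = (v - w₀) + (w - v) := by simp [d]
    have h5 : ‖v - w₀‖ ≤ ‖d‖ + δ := by
      have : v - w₀ = d - (w - v) := by simp [d]
      rw [this]
      exact (norm_sub_le _ _).trans (by linarith)
    have h6 : inner ℝ (b - p) (w - v) ≤ B * δ := by
      calc _ ≤ ‖b - p‖ * ‖w - v‖ := real_inner_le_norm _ _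
        _ ≤ D * η := mul_le_mul hD hv (norm_nonneg _) ((norm_nonneg _).trans hD)
        _ ≤ _ := hDη
    rw [h4, inner_add_right, ← h4]
    nlinarith
  have h4 : ‖d‖ ≤ 3 * B + 4 * δ + 2 * τ := by
    have hd := norm_nonneg d
    by_contra! hlt
    nlinarith [mul_nonneg hB hδ]
  have h5 : w - p = d + (w₀ - p) := by simp [d]
  calc ‖w - p‖ ≤ ‖d‖ + τ := by rw [h5]; exact norm_add_le _ _
    _ ≤ _ := by linarith

/-! ### Gaussian moments -/

section GaussianMoments

variable {n : ℕ}

lemma hasLaw_inner_stdGaussian (u : EuclideanSpace ℝ (Fin n)) :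
    HasLaw (fun a => inner ℝ a u) (gaussianReal 0 (‖u‖₊ ^ 2))
      (stdGaussian (EuclideanSpace ℝ (Fin n))) where
  aemeasurable := by fun_prop
  map_eq := by
    have h := (IsGaussian.hasGaussianLaw_id (μ := stdGaussian (EuclideanSpace ℝ (Fin n)))).map_fun
      (innerSL ℝ u)
    have h1 := h.map_eq_gaussianReal
    have h2 := integral_strongDual_stdGaussian (innerSL ℝ u)
    have h3 := variance_dual_stdGaussian (innerSL ℝ u)
    simp only [id_eq] at h1
    rw [h2, h3, innerSL_apply_norm] at h1
    convert h1 using 2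
    · ext a
      simp [real_inner_comm]
    · ext
      simp

/-- Projections of a standard Gaussian vector onto orthogonal directions are independent. -/
lemma hasLaw_inner_prod_stdGaussian {x v : EuclideanSpace ℝ (Fin n)} (hx : ‖x‖ = 1)
    (hv : inner ℝ x v = 0) :
    HasLaw (fun a => (inner ℝ a x, inner ℝ a v))
      ((gaussianReal 0 1).prod (gaussianReal 0 (‖v‖₊ ^ 2)))
      (stdGaussian (EuclideanSpace ℝ (Fin n))) := by
  have hx' : HasLaw (fun a => inner ℝ a x) (gaussianReal 0 1)
      (stdGaussian (EuclideanSpace ℝ (Fin n))) := by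
    have h := hasLaw_inner_stdGaussian x
    have : ‖x‖₊ = 1 := by ext; simpa using hx
    simpa [this] using h
  refine IndepFun.hasLaw_prod hx' (hasLaw_inner_stdGaussian v) ?_
  have hlaw : HasGaussianLaw (fun a => (inner ℝ a x, inner ℝ a v))
      (stdGaussian (EuclideanSpace ℝ (Fin n))) := by
    have h := (IsGaussian.hasGaussianLaw_id
      (μ := stdGaussian (EuclideanSpace ℝ (Fin n)))).map_fun ((innerSL ℝ x).prod (innerSL ℝ v))
    simpa [real_inner_comm] using h
  refine hlaw.indepFun_of_covariance_eq_zero ?_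
  have h := covarianceBilin_apply_eq_cov (μ := stdGaussian (EuclideanSpace ℝ (Fin n)))
    IsGaussian.memLp_two_id x v
  rw [covarianceBilin_stdGaussian, innerSL_apply_apply, hv] at h
  simpa only [real_inner_comm] using h.symm

lemma lintegral_exp_mul_gaussianReal (v : ℝ≥0) (t : ℝ) :
    ∫⁻ z, ENNReal.ofReal (Real.exp (t * z)) ∂gaussianReal 0 v =
      ENNReal.ofReal (Real.exp (v * t ^ 2 / 2)) := by
  rw [← ofReal_integral_eq_lintegral_ofReal (integrable_exp_mul_gaussianReal t)
    (Filter.Eventually.of_forall fun _ => (Real.exp_pos _).le)]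
  have h := congrFun (mgf_id_gaussianReal (μ := 0) (v := v)) t
  simp only [mgf, id_eq] at h
  rw [h]
  simp

lemma lintegral_exp_sq_div_four_gaussianReal :
    ∫⁻ z, ENNReal.ofReal (Real.exp (z ^ 2 / 4)) ∂gaussianReal 0 1 =
      ENNReal.ofReal (Real.sqrt 2) := by
  have h : ∀ z : ℝ, gaussianPDFReal 0 1 z * Real.exp (z ^ 2 / 4) =
      (Real.sqrt (2 * Real.pi))⁻¹ * Real.exp (-(1 / 4) * z ^ 2) := by
    intro z
    rw [gaussianPDFReal, mul_assoc, ← Real.exp_add]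
    congr 2
    · simp
    · simp
      ring
  rw [gaussianReal_of_var_ne_zero 0 one_ne_zero,
    lintegral_withDensity_eq_lintegral_mul _ (measurable_gaussianPDF 0 1) (by fun_prop)]
  simp only [Pi.mul_apply, gaussianPDF, ← ENNReal.ofReal_mul (gaussianPDFReal_nonneg _ _ _), h]
  rw [← ofReal_integral_eq_lintegral_ofReal
    ((integrable_exp_neg_mul_sq (by norm_num)).const_mul _)
    (Filter.Eventually.of_forall fun _ => by positivity), integral_const_mul, integral_gaussian]
  congr 1
  rw [← Real.sqrt_inv, ← Real.sqrt_mul (by positivity)]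
  congr 1
  have := Real.pi_pos.ne'
  field_simp
  norm_num

lemma lintegral_exp_inner_sq_stdGaussian_le {u : EuclideanSpace ℝ (Fin n)} (hu : ‖u‖ ≤ 1) :
    ∫⁻ a, ENNReal.ofReal (Real.exp (inner ℝ a u ^ 2 / 4))
      ∂stdGaussian (EuclideanSpace ℝ (Fin n)) ≤ ENNReal.ofReal (Real.sqrt 2) := by
  have h1 := (hasLaw_inner_stdGaussian u).lintegral_comp
    (f := fun z => ENNReal.ofReal (Real.exp (z ^ 2 / 4))) (by fun_prop)
  have h2 := (gaussianReal_const_mul (HasLaw.id (μ := gaussianReal 0 1)) ‖u‖).lintegral_comp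
    (f := fun z => ENNReal.ofReal (Real.exp (z ^ 2 / 4))) (by fun_prop)
  have h3 : NNReal.mk (‖u‖ ^ 2) (sq_nonneg _) * 1 = ‖u‖₊ ^ 2 := by
    rw [mul_one]
    rfl
  rw [h3, mul_zero] at h2
  rw [h1, ← h2, ← lintegral_exp_sq_div_four_gaussianReal]
  refine lintegral_mono fun z => ENNReal.ofReal_le_ofReal (Real.exp_le_exp.2 ?_)
  have : ‖u‖ ^ 2 ≤ 1 := pow_le_one₀ (norm_nonneg _) hu
  simp only [id_eq, mul_pow]
  nlinarith [sq_nonneg z]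

/-- For `a` standard Gaussian, `s` independent of `a`, and `v` orthogonal to `x`, the variable
`⟪a, v⟫` is independent of `q = F s ⟪a, x⟫`; conditionally on `q`, the product `q * ⟪a, v⟫` is
Gaussian of variance at most `q ^ 2`. -/
lemma lintegral_exp_mul_inner_le {S : Type*} [MeasurableSpace S] (κ : Measure S)
    [IsProbabilityMeasure κ] {F : S → ℝ → ℝ} (hF : Measurable (Function.uncurry F))
    {x v : EuclideanSpace ℝ (Fin n)} (hx : ‖x‖ = 1) (hv : inner ℝ x v = 0) (hv1 : ‖v‖ ≤ 1)
    (t : ℝ) :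
    ∫⁻ p, ENNReal.ofReal (Real.exp (t * (F p.2 (inner ℝ p.1 x) * inner ℝ p.1 v)
        - t ^ 2 / 2 * F p.2 (inner ℝ p.1 x) ^ 2))
      ∂(stdGaussian (EuclideanSpace ℝ (Fin n))).prod κ ≤ 1 := by
  have hm : Measurable fun p : EuclideanSpace ℝ (Fin n) × S => F p.2 (inner ℝ p.1 x) :=
    hF.comp (measurable_snd.prodMk (by fun_prop))
  rw [lintegral_prod_symm _ (by fun_prop)]
  refine (lintegral_mono fun s => ?_).trans_eq (lintegral_one.trans measure_univ)
  have hFs : Measurable (F s) := hF.comp measurable_prodMk_left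
  have h := (hasLaw_inner_prod_stdGaussian hx hv).lintegral_comp
    (f := fun q => ENNReal.ofReal (Real.exp (t * (F s q.1 * q.2) - t ^ 2 / 2 * F s q.1 ^ 2)))
    (by fun_prop)
  dsimp only at h ⊢
  rw [h, lintegral_prod _ (by fun_prop)]
  refine (lintegral_mono fun g => ?_).trans_eq (lintegral_one.trans measure_univ)
  have h1 : ∀ z : ℝ, ENNReal.ofReal (Real.exp (t * (F s g * z) - t ^ 2 / 2 * F s g ^ 2)) =
      ENNReal.ofReal (Real.exp (-(t ^ 2 / 2 * F s g ^ 2))) *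
        ENNReal.ofReal (Real.exp ((t * F s g) * z)) := by
    intro z
    rw [← ENNReal.ofReal_mul (Real.exp_pos _).le, ← Real.exp_add]
    congr 2
    ring
  simp only [h1]
  rw [lintegral_const_mul _ (by fun_prop), lintegral_exp_mul_gaussianReal,
    ← ENNReal.ofReal_mul (Real.exp_pos _).le, ← Real.exp_add]
  refine ENNReal.ofReal_le_one.2 (Real.exp_le_one_iff.2 ?_)
  have : ‖v‖ ^ 2 ≤ 1 := pow_le_one₀ (norm_nonneg _) hv1
  simp only [NNReal.coe_pow, coe_nnnorm]
  nlinarith [sq_nonneg (t * F s g)]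

end GaussianMoments

/-! ### Tail bounds for sums of independent variables -/

section Tails

variable {α : Type*} [MeasurableSpace α] (π : Measure α) [IsProbabilityMeasure π] {m : ℕ}

/-- Chernoff's bound for a sum of independent copies of `h`. -/
lemma pi_real_le_sum_le {h : α → ℝ} (hh : Measurable h) {M : ℝ} (hM : 0 ≤ M)
    (hint : ∫⁻ p, ENNReal.ofReal (Real.exp (h p)) ∂π ≤ ENNReal.ofReal M) (t : ℝ) :
    (Measure.pi fun _ : Fin m => π).real {ω | t ≤ ∑ i, h (ω i)} ≤ M ^ m * Real.exp (-t) := by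
  set Q := Measure.pi fun _ : Fin m => π
  have hprod : ∫⁻ ω, ∏ i, ENNReal.ofReal (Real.exp (h (ω i))) ∂Q ≤ ENNReal.ofReal (M ^ m) := by
    have hm : Measurable fun p => ENNReal.ofReal (Real.exp (h p)) := by fun_prop
    rw [lintegral_prod_eq_prod_lintegral_of_indepFun Finset.univ _
      (iIndepFun_pi (μ := fun _ : Fin m => π) fun _ => hm.aemeasurable)
      (fun i => hm.comp (measurable_pi_apply i))]
    rw [ENNReal.ofReal_pow hM]
    refine (Finset.prod_le_pow_card _ _ (ENNReal.ofReal M) fun i _ => ?_).trans_eq (by simp)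
    rw [(measurePreserving_eval (fun _ : Fin m => π) i).lintegral_comp hm]
    exact hint
  have hmeas : Measurable fun ω : Fin m → α => ∏ i, ENNReal.ofReal (Real.exp (h (ω i))) := by
    fun_prop
  have hmarkov := meas_ge_le_lintegral_div (μ := Q) hmeas.aemeasurable
    (ε := ENNReal.ofReal (Real.exp t)) (by simp [Real.exp_pos]) ENNReal.ofReal_ne_top
  have hset : {ω : Fin m → α | t ≤ ∑ i, h (ω i)} =
      {ω | ENNReal.ofReal (Real.exp t) ≤ ∏ i, ENNReal.ofReal (Real.exp (h (ω i)))} := by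
    ext ω
    rw [Set.mem_ofPred_eq, Set.mem_ofPred_eq, ← ENNReal.ofReal_prod_of_nonneg
      fun i _ => (Real.exp_pos _).le, ← Real.exp_sum,
      ENNReal.ofReal_le_ofReal_iff (Real.exp_pos _).le, Real.exp_le_exp]
  rw [hset, measureReal_def]
  refine ENNReal.toReal_le_of_le_ofReal (by positivity) (hmarkov.trans ?_)
  rw [Real.exp_neg, ← div_eq_mul_inv, ENNReal.ofReal_div_of_pos (Real.exp_pos _)]
  gcongr

/-- Chebyshev's inequality for the empirical mean of independent copies of `h`. -/
lemma pi_real_le_abs_mean_sub_le {h : α → ℝ} (hh : MemLp h 2 π) (hm : 0 < m) {ε : ℝ}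
    (hε : 0 < ε) :
    (Measure.pi fun _ : Fin m => π).real {ω | ε ≤ |1 / (m : ℝ) * ∑ i, h (ω i) - ∫ p, h p ∂π|} ≤
      variance h π / (m * ε ^ 2) := by
  set Q := Measure.pi fun _ : Fin m => π
  have hm' : (0 : ℝ) < m := by exact_mod_cast hm
  have hev : ∀ i : Fin m, MemLp (fun ω : Fin m → α => h (ω i)) 2 Q := fun i =>
    hh.comp_measurePreserving (measurePreserving_eval (fun _ : Fin m => π) i)
  have hsum : MemLp (∑ i : Fin m, fun ω : Fin m → α => h (ω i)) 2 Q :=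
    memLp_finsetSum' _ fun i _ => hev i
  have hmean : ∫ ω, (∑ i : Fin m, fun ω : Fin m → α => h (ω i)) ω ∂Q = m * ∫ p, h p ∂π := by
    simp only [Finset.sum_apply]
    rw [integral_finsetSum _ fun i _ => (hev i).integrable (by norm_num)]
    have : ∀ i : Fin m, ∫ ω, h (ω i) ∂Q = ∫ p, h p ∂π := fun i =>
      integral_comp_eval hh.aestronglyMeasurable
    simp [this]
  have hvar : variance (∑ i : Fin m, fun ω : Fin m → α => h (ω i)) Q = m * variance h π := by
    rw [variance_sum_pi (fun _ => hh)]
    simp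
  have hcheb := meas_ge_le_variance_div_sq hsum (c := m * ε) (by positivity)
  rw [hmean, hvar] at hcheb
  have hset : {ω : Fin m → α | ε ≤ |1 / (m : ℝ) * ∑ i, h (ω i) - ∫ p, h p ∂π|} =
      {ω | m * ε ≤ |(∑ i : Fin m, fun ω : Fin m → α => h (ω i)) ω - m * ∫ p, h p ∂π|} := by
    ext ω
    have : (∑ i : Fin m, fun ω : Fin m → α => h (ω i)) ω - m * ∫ p, h p ∂π =
        m * (1 / (m : ℝ) * ∑ i, h (ω i) - ∫ p, h p ∂π) := by
      simp only [Finset.sum_apply]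
      field_simp
    rw [Set.mem_ofPred_eq, Set.mem_ofPred_eq, this, abs_mul, abs_of_pos hm',
      mul_le_mul_iff_right₀ hm']
  rw [hset, measureReal_def]
  refine (ENNReal.toReal_le_of_le_ofReal
    (div_nonneg (mul_nonneg hm'.le (variance_nonneg _ _)) (sq_nonneg _)) hcheb).trans_eq ?_
  field_simp

end Tails

/-! ### The moments of the nonlinearity -/

section Moments

variable {S : Type*} [MeasurableSpace S] {F : S → ℝ → ℝ} {κ : Measure S}

lemma xi_sq : xi F κ ^ 2 = ∫ p, F p.1 p.2 ^ 2 ∂jointLaw κ :=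
  Real.sq_sqrt (integral_nonneg fun _ => sq_nonneg _)

lemma memLp_two_sq (hF : Measurable (Function.uncurry F))
    (hF4 : Integrable (fun p : S × ℝ => F p.1 p.2 ^ 4) (jointLaw κ)) :
    MemLp (fun p : S × ℝ => F p.1 p.2 ^ 2) 2 (jointLaw κ) := by
  have hF' : Measurable fun p : S × ℝ => F p.1 p.2 := hF
  rw [memLp_two_iff_integrable_sq (hF'.pow_const 2).aestronglyMeasurable]
  simpa only [← pow_mul] using hF4

lemma memLp_two_mul [IsProbabilityMeasure κ] (hF : Measurable (Function.uncurry F))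
    (hF4 : Integrable (fun p : S × ℝ => F p.1 p.2 ^ 4) (jointLaw κ)) :
    MemLp (fun p : S × ℝ => F p.1 p.2 * p.2) 2 (jointLaw κ) := by
  have hF' : Measurable fun p : S × ℝ => F p.1 p.2 := hF
  have hm : Measurable fun p : S × ℝ => F p.1 p.2 * p.2 := hF'.mul measurable_snd
  rw [memLp_two_iff_integrable_sq hm.aestronglyMeasurable]
  have hg4 : Integrable (fun p : S × ℝ => p.2 ^ 4) (jointLaw κ) := by
    have h := (memLp_id_gaussianReal (μ := 0) (v := 1) 4).integrable_norm_pow (by norm_num)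
    have h' : Integrable (fun z : ℝ => z ^ 4) (gaussianReal 0 1) := by
      refine h.congr (Filter.Eventually.of_forall fun z => ?_)
      change |z| ^ 4 = z ^ 4
      exact Even.pow_abs (by decide) z
    exact h'.comp_snd κ
  refine (hF4.add hg4).mono' (hm.pow_const 2).aestronglyMeasurable
    (Filter.Eventually.of_forall fun p => ?_)
  rw [Real.norm_of_nonneg (sq_nonneg _)]
  simp only [Pi.add_apply]
  nlinarith [sq_nonneg (F p.1 p.2 ^ 2 - p.2 ^ 2), sq_nonneg (F p.1 p.2 ^ 2 + p.2 ^ 2)]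

/-- For a unit vector `x`, the pair `(s, ⟪a, x⟫)` has the joint law of `f` and an independent
standard normal variable. -/
lemma measurePreserving_jointLaw [IsProbabilityMeasure κ] {n : ℕ}
    {x : EuclideanSpace ℝ (Fin n)} (hx : ‖x‖ = 1) :
    MeasurePreserving (fun p : EuclideanSpace ℝ (Fin n) × S => (p.2, (inner ℝ p.1 x : ℝ)))
      ((stdGaussian (EuclideanSpace ℝ (Fin n))).prod κ) (jointLaw κ) := by
  have h := hasLaw_inner_stdGaussian x
  have hx' : ‖x‖₊ = 1 := by ext; simpa using hx
  rw [hx', one_pow] at h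
  have h1 : MeasurePreserving (fun a : EuclideanSpace ℝ (Fin n) => (inner ℝ a x : ℝ))
      (stdGaussian (EuclideanSpace ℝ (Fin n))) (gaussianReal 0 1) :=
    h.measurePreserving (by fun_prop)
  exact ((MeasurePreserving.id κ).prod h1).comp Measure.measurePreserving_swap

end Moments

/-! ### The event on which the test directions are controlled -/

section GoodEvent

variable {S : Type*} [MeasurableSpace S] {F : S → ℝ → ℝ} {κ : Measure S} [IsProbabilityMeasure κ]
  {n m : ℕ}

local notation "𝔼ₙ" => EuclideanSpace ℝ (Fin n)

/-- The weighted sum `∑ qᵢ ⟪aᵢ, v⟫` is sub-Gaussian with variance proxy `Q` on the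
event `∑ qᵢ² ≤ Q`. -/
lemma pi_real_sum_mul_inner_le (hF : Measurable (Function.uncurry F)) {x v : 𝔼ₙ} (hx : ‖x‖ = 1)
    (hv : inner ℝ x v = 0) (hv1 : ‖v‖ ≤ 1) {t Q : ℝ} (hQ : 0 < Q) (ht : 0 ≤ t) :
    (Measure.pi fun _ : Fin m => (stdGaussian 𝔼ₙ).prod κ).real
      {p | ∑ i, F (p i).2 (inner ℝ (p i).1 x) ^ 2 ≤ Q ∧
        t ≤ ∑ i, F (p i).2 (inner ℝ (p i).1 x) * inner ℝ (p i).1 v} ≤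
      Real.exp (-(t ^ 2 / (2 * Q))) := by
  have hm : Measurable fun p : 𝔼ₙ × S => F p.2 (inner ℝ p.1 x) :=
    hF.comp (measurable_snd.prodMk (by fun_prop))
  have h := pi_real_le_sum_le ((stdGaussian 𝔼ₙ).prod κ) (m := m)
    (h := fun p => t / Q * (F p.2 (inner ℝ p.1 x) * inner ℝ p.1 v)
      - (t / Q) ^ 2 / 2 * F p.2 (inner ℝ p.1 x) ^ 2) (by fun_prop) zero_le_one
    (by simpa using lintegral_exp_mul_inner_le κ hF hx hv hv1 (t / Q)) (t ^ 2 / (2 * Q))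
  rw [one_pow, one_mul] at h
  refine le_trans (measureReal_mono fun p hp => ?_) h
  obtain ⟨h1, h2⟩ := hp
  rw [Set.mem_ofPred_eq, Finset.sum_sub_distrib, ← Finset.mul_sum, ← Finset.mul_sum]
  have h3 : t / Q * t - (t / Q) ^ 2 / 2 * Q = t ^ 2 / (2 * Q) := by
    field_simp
    ring
  rw [← h3]
  gcongr

lemma pi_real_sum_inner_sq_le {u : 𝔼ₙ} (hu : ‖u‖ ≤ 1) (K : ℝ) :
    (Measure.pi fun _ : Fin m => (stdGaussian 𝔼ₙ).prod κ).real
      {p | K * m ≤ ∑ i, inner ℝ (p i).1 u ^ 2} ≤ Real.exp (-((K / 4 - 1 / 2) * m)) := by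
  have hint : ∫⁻ p, ENNReal.ofReal (Real.exp (inner ℝ p.1 u ^ 2 / 4))
      ∂(stdGaussian 𝔼ₙ).prod κ ≤ ENNReal.ofReal (Real.sqrt 2) := by
    have hm : Measurable fun a : 𝔼ₙ => ENNReal.ofReal (Real.exp (inner ℝ a u ^ 2 / 4)) := by
      fun_prop
    rw [measurePreserving_fst.lintegral_comp hm]
    exact lintegral_exp_inner_sq_stdGaussian_le hu
  have h := pi_real_le_sum_le ((stdGaussian 𝔼ₙ).prod κ) (m := m)
    (h := fun p => inner ℝ p.1 u ^ 2 / 4) (by fun_prop) (Real.sqrt_nonneg 2) hint (K * m / 4)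
  refine le_trans (measureReal_mono fun p hp => ?_) (h.trans ?_)
  · rw [Set.mem_ofPred_eq, ← Finset.sum_div]
    exact div_le_div_of_nonneg_right hp (by norm_num)
  · have h2 : Real.sqrt 2 ≤ Real.exp (1 / 2) := by
      rw [Real.sqrt_le_left (Real.exp_pos _).le, ← Real.exp_nat_mul]
      have := Real.add_one_le_exp (1 : ℝ)
      norm_num at this ⊢
      linarith
    calc Real.sqrt 2 ^ m * Real.exp (-(K * m / 4))
        ≤ Real.exp (1 / 2) ^ m * Real.exp (-(K * m / 4)) := by gcongr
      _ = _ := by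
        rw [← Real.exp_nat_mul, ← Real.exp_add]
        congr 1
        ring

/-- Decomposition of the noiseless back-projection error along `u`: the part along `x` is a
deviation of an empirical mean, and the part along the component of `u` orthogonal to `x` is, given
the weights `q`, a centred Gaussian variable. -/
lemma inner_backProj_sub {a : Fin m → 𝔼ₙ} {q : Fin m → ℝ} {x u : 𝔼ₙ} (μ : ℝ) :
    inner ℝ (backProj a q - μ • x) u =
      (1 / (m : ℝ) * ∑ i, q i * inner ℝ (a i) x - μ) * inner ℝ x u +
        1 / (m : ℝ) * ∑ i, q i * inner ℝ (a i) (u - (inner ℝ x u : ℝ) • x) := by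
  simp only [backProj, inner_sub_left, inner_sub_right, real_inner_smul_left,
    real_inner_smul_right, sum_inner, mul_sub, Finset.sum_sub_distrib]
  have h : ∀ i, q i * (inner ℝ x u * inner ℝ (a i) x) =
      inner ℝ x u * (q i * inner ℝ (a i) x) := fun i => by ring
  simp only [h, ← Finset.mul_sum]
  ring

/-- The directions `u` in a finite set `U` of vectors of the unit ball are all controlled outside an
event of small probability. The two variance terms come from Chebyshev's inequality for the
empirical means of `f(g) ^ 2` and of `f(g) g`; they do not depend on `U`. The exponential term is a
union bound over `U`. -/
lemma exists_bad_event (hF : Measurable (Function.uncurry F))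
    (hF4 : Integrable (fun p : S × ℝ => F p.1 p.2 ^ 4) (jointLaw κ)) {x : 𝔼ₙ} (hx : ‖x‖ = 1)
    {c₃ l : ℝ} (hc₃ : 0 < c₃) (hl : 1 ≤ l) (hm : 0 < m) (hlm : c₃ * l ≤ m) (hξ : 0 < xi F κ)
    (U : Finset 𝔼ₙ) (hU : ∀ u ∈ U, ‖u‖ ≤ 1) (hcard : (U.card : ℝ) ≤ Real.exp (4 * l)) :
    ∃ Bad : Set (Fin m → 𝔼ₙ × S),
      (Measure.pi fun _ : Fin m => (stdGaussian 𝔼ₙ).prod κ).real Bad ≤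
        Real.exp (-l) + thetaFourth F κ / (m * xi F κ ^ 4) + rhoSq F κ / (xi F κ ^ 2 * l) ∧
      ∀ p ∉ Bad, ∀ u ∈ U,
        |inner ℝ (backProj (fun i => (p i).1) (fun i => F (p i).2 (inner ℝ (p i).1 x))
          - meanParam F κ • x) u| ≤ 7 * (xi F κ * Real.sqrt (l / m)) ∧
        ∑ i, inner ℝ (p i).1 u ^ 2 ≤ (2 + 28 / c₃) * m := by
  set π := (stdGaussian 𝔼ₙ).prod κ
  set Q := Measure.pi fun _ : Fin m => π
  set ξ := xi F κ
  set ε := ξ * Real.sqrt (l / m)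
  have hm' : (0 : ℝ) < m := by exact_mod_cast hm
  have hl0 : 0 < l := by linarith
  have hε : 0 < ε := by positivity
  have hεsq : ε ^ 2 = ξ ^ 2 * (l / m) := by
    simp only [ε, mul_pow]
    rw [Real.sq_sqrt (by positivity)]
  have hT := measurePreserving_jointLaw (κ := κ) hx
  -- the two events controlled by Chebyshev's inequality
  set q : 𝔼ₙ × S → ℝ := fun p => F p.2 (inner ℝ p.1 x)
  set B₁ : Set (Fin m → 𝔼ₙ × S) := {p | ξ ^ 2 ≤ |1 / (m : ℝ) * ∑ i, q (p i) ^ 2 - ξ ^ 2|}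
  set B₂ : Set (Fin m → 𝔼ₙ × S) :=
    {p | ε ≤ |1 / (m : ℝ) * ∑ i, q (p i) * inner ℝ (p i).1 x - meanParam F κ|}
  have hB₁ : Q.real B₁ ≤ thetaFourth F κ / (m * ξ ^ 4) := by
    have hmem := memLp_two_sq hF hF4
    have h := pi_real_le_abs_mean_sub_le π (m := m) (hmem.comp_measurePreserving hT) hm
      (show 0 < ξ ^ 2 by positivity)
    have hint := integral_map (μ := π) hT.measurable.aemeasurable
      (f := fun p : S × ℝ => F p.1 p.2 ^ 2) (by rw [hT.map_eq]; exact hmem.aestronglyMeasurable)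
    rw [hT.map_eq, ← xi_sq] at hint
    have hvar := variance_map (μ := π) (X := fun p : S × ℝ => F p.1 p.2 ^ 2)
      (by rw [hT.map_eq]; exact hmem.aestronglyMeasurable.aemeasurable) hT.measurable.aemeasurable
    rw [hT.map_eq] at hvar
    rw [← hvar] at h
    simp only [Function.comp_apply] at h
    rw [← hint, ← pow_mul] at h
    exact h
  have hB₂ : Q.real B₂ ≤ rhoSq F κ / (ξ ^ 2 * l) := by
    have hmem := memLp_two_mul hF hF4
    have h := pi_real_le_abs_mean_sub_le π (m := m) (hmem.comp_measurePreserving hT) hm hε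
    have hint := integral_map (μ := π) hT.measurable.aemeasurable
      (f := fun p : S × ℝ => F p.1 p.2 * p.2) (by rw [hT.map_eq]; exact hmem.aestronglyMeasurable)
    rw [hT.map_eq] at hint
    have hvar := variance_map (μ := π) (X := fun p : S × ℝ => F p.1 p.2 * p.2)
      (by rw [hT.map_eq]; exact hmem.aestronglyMeasurable.aemeasurable) hT.measurable.aemeasurable
    rw [hT.map_eq] at hvar
    rw [← hvar] at h
    simp only [Function.comp_apply] at h
    rw [← hint, hεsq] at h
    refine h.trans_eq ?_
    rw [rhoSq]
    congr 1
    field_simp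
  -- the events controlled by the union bound over `U`
  set K := 2 + 28 / c₃
  set t := 6 * (ξ * Real.sqrt (m * l))
  set W := 2 * m * ξ ^ 2
  have ht : 0 ≤ t := by positivity
  have hW : 0 < W := by positivity
  set v : 𝔼ₙ → 𝔼ₙ := fun u => u - (inner ℝ x u : ℝ) • x
  have hv : ∀ u, inner ℝ x (v u) = 0 := fun u => by
    simp [v, inner_sub_right, real_inner_smul_right, hx]
  have hv1 : ∀ u, ‖u‖ ≤ 1 → ‖v u‖ ≤ 1 := fun u hu => by
    have h1 : ‖v u‖ ^ 2 ≤ ‖u‖ ^ 2 := by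
      have h2 : u = v u + (inner ℝ x u : ℝ) • x := by simp [v]
      have h3 := norm_add_sq_real (v u) ((inner ℝ x u : ℝ) • x)
      rw [← h2, real_inner_smul_right, real_inner_comm x (v u), hv] at h3
      nlinarith [sq_nonneg ‖(inner ℝ x u : ℝ) • x‖]
    exact (pow_le_pow_iff_left₀ (norm_nonneg _) (norm_nonneg _) two_ne_zero).1 h1 |>.trans hu
  have htW : t ^ 2 / (2 * W) = 9 * l := by
    simp only [t, W, mul_pow]
    rw [Real.sq_sqrt (by positivity)]
    field_simp
    norm_num
  set D : 𝔼ₙ → Set (Fin m → 𝔼ₙ × S) := fun w =>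
    {p | ∑ i, q (p i) ^ 2 ≤ W ∧ t ≤ ∑ i, q (p i) * inner ℝ (p i).1 w}
  set A : 𝔼ₙ → Set (Fin m → 𝔼ₙ × S) := fun u => {p | K * m ≤ ∑ i, inner ℝ (p i).1 u ^ 2}
  have hD : ∀ w, inner ℝ x w = 0 → ‖w‖ ≤ 1 → Q.real (D w) ≤ Real.exp (-(7 * l)) := by
    intro w hw hw1
    refine (pi_real_sum_mul_inner_le hF hx hw hw1 hW ht).trans (Real.exp_le_exp.2 ?_)
    rw [htW]
    linarith
  have hA : ∀ u, ‖u‖ ≤ 1 → Q.real (A u) ≤ Real.exp (-(7 * l)) := by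
    intro u hu
    refine (pi_real_sum_inner_sq_le hu K).trans (Real.exp_le_exp.2 ?_)
    have : (K / 4 - 1 / 2) * m = 7 * (m / c₃) := by
      simp only [K]
      ring
    rw [this]
    have : l ≤ m / c₃ := by
      rw [le_div_iff₀ hc₃]
      linarith
    linarith
  set B₃ : Set (Fin m → 𝔼ₙ × S) := ⋃ u ∈ U, (D (v u) ∪ D (-v u) ∪ A u)
  have hB₃ : Q.real B₃ ≤ Real.exp (-l) := by
    have h1 : ∀ u ∈ U, Q.real (D (v u) ∪ D (-v u) ∪ A u) ≤ 3 * Real.exp (-(7 * l)) := by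
      intro u hu
      have h2 := measureReal_union_le (μ := Q) (D (v u) ∪ D (-v u)) (A u)
      have h3 := measureReal_union_le (μ := Q) (D (v u)) (D (-v u))
      have h4 := hD (v u) (hv u) (hv1 u (hU u hu))
      have h5 := hD (-v u) (by rw [inner_neg_right, hv, neg_zero])
        (by rw [norm_neg]; exact hv1 u (hU u hu))
      have h6 := hA u (hU u hu)
      linarith
    have h3 : (3 : ℝ) ≤ Real.exp (2 * l) := by
      have := Real.add_one_le_exp (2 * l)
      linarith
    calc Q.real B₃ ≤ ∑ u ∈ U, Q.real (D (v u) ∪ D (-v u) ∪ A u) :=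
          measureReal_biUnion_finset_le _ _
      _ ≤ ∑ _u ∈ U, 3 * Real.exp (-(7 * l)) := Finset.sum_le_sum h1
      _ = U.card * (3 * Real.exp (-(7 * l))) := by simp
      _ ≤ Real.exp (4 * l) * (Real.exp (2 * l) * Real.exp (-(7 * l))) := by gcongr
      _ = Real.exp (-l) := by
        rw [← Real.exp_add, ← Real.exp_add]
        congr 1
        ring
  refine ⟨B₃ ∪ B₁ ∪ B₂, ?_, fun p hp u hu => ?_⟩
  · have h1 := measureReal_union_le (μ := Q) (B₃ ∪ B₁) B₂
    have h2 := measureReal_union_le (μ := Q) B₃ B₁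
    linarith
  · simp only [Set.mem_union, not_or] at hp
    obtain ⟨⟨hp₃, hp₁⟩, hp₂⟩ := hp
    have hp₃' : p ∉ D (v u) ∪ D (-v u) ∪ A u := fun h => hp₃ (Set.mem_biUnion hu h)
    simp only [Set.mem_union, not_or] at hp₃'
    obtain ⟨⟨hD₁, hD₂⟩, hA'⟩ := hp₃'
    have hsq : ∑ i, q (p i) ^ 2 ≤ W := by
      have h : |1 / (m : ℝ) * ∑ i, q (p i) ^ 2 - ξ ^ 2| < ξ ^ 2 := not_le.1 hp₁
      replace h := (abs_lt.1 h).2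
      have h2 : 1 / (m : ℝ) * ∑ i, q (p i) ^ 2 < 2 * ξ ^ 2 := by linarith
      rw [one_div_mul_eq_div, div_lt_iff₀ hm'] at h2
      simp only [W]
      linarith
    have hD₁' : ∑ i, q (p i) * inner ℝ (p i).1 (v u) < t := not_le.1 fun h => hD₁ ⟨hsq, h⟩
    have hD₂' : -∑ i, q (p i) * inner ℝ (p i).1 (v u) < t := by
      refine not_le.1 fun h => hD₂ ⟨hsq, ?_⟩
      simpa [inner_neg_right] using h
    refine ⟨?_, (not_le.1 hA').le⟩
    rw [inner_backProj_sub]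
    have hxu : |inner ℝ x u| ≤ 1 := by
      refine (abs_real_inner_le_norm _ _).trans ?_
      rw [hx, one_mul]
      exact hU u hu
    have htm : 1 / (m : ℝ) * t = 6 * ε := by
      have : Real.sqrt (m * l) = m * Real.sqrt (l / m) := by
        rw [show (m : ℝ) * l = m ^ 2 * (l / m) by field_simp, Real.sqrt_mul (by positivity),
          Real.sqrt_sq hm'.le]
      simp only [t, ε, this]
      field_simp
    have h1 : |(1 / (m : ℝ) * ∑ i, q (p i) * inner ℝ (p i).1 x - meanParam F κ) * inner ℝ x u|
        ≤ ε := by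
      rw [abs_mul]
      calc _ ≤ ε * 1 := mul_le_mul (not_le.1 hp₂).le hxu (abs_nonneg _) hε.le
        _ = ε := mul_one _
    have h2 : |1 / (m : ℝ) * ∑ i, q (p i) * inner ℝ (p i).1 (v u)| ≤ 6 * ε := by
      rw [abs_mul, abs_of_pos (show (0 : ℝ) < 1 / m by positivity), ← htm]
      gcongr
      exact abs_le.2 ⟨by linarith, hD₁'.le⟩
    refine (abs_add_le _ _).trans ?_
    linarith

end GoodEvent

/-! ### Test directions, observation noise and joint law -/

/-- A finite set `U` of test directions for the range of `G`, seen from `w₀`: the normalized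
differences `v - w₀`, with `v` in a net of the range of radius `δ / √n`, and the coordinate vectors.
The net yields the inner product with `w - w₀` up to an error `‖b - p‖ δ / √n`; the coordinate
vectors yield `‖b - p‖ ≤ √n B`, so that this error is at most `B δ`. -/
lemma exists_test_directions {k n : ℕ} {r : ℝ} {L : ℝ≥0}
    {G : LatentBall k r → EuclideanSpace ℝ (Fin n)} (hG : LipschitzWith L G) {δ Λ : ℝ}
    (hδ : 0 < δ) (hk : 0 < k) (hn : 0 < n) (hΛ : 2 ≤ Λ) (hexp : L * r / δ = Real.exp Λ)
    (hnΛ : (n : ℝ) ≤ Real.exp (2 * Λ)) (w₀ : EuclideanSpace ℝ (Fin n)) :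
    ∃ U : Finset (EuclideanSpace ℝ (Fin n)), (∀ u ∈ U, ‖u‖ ≤ 1) ∧
      (U.card : ℝ) ≤ Real.exp (4 * (k * Λ)) ∧
      ∀ (b p w : EuclideanSpace ℝ (Fin n)) (B : ℝ), 0 ≤ B → w ∈ Set.range G →
        ‖w - b‖ ≤ ‖w₀ - b‖ → (∀ u ∈ U, |inner ℝ (b - p) u| ≤ B) →
        ‖w - p‖ ≤ 3 * B + 4 * δ + 3 * ‖w₀ - p‖ := by
  classical
  have hn1 : (1 : ℝ) ≤ n := by exact_mod_cast hn
  have hk1 : (1 : ℝ) ≤ k := by exact_mod_cast hk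
  have hsn : 1 ≤ Real.sqrt n := Real.one_le_sqrt.2 hn1
  have hsn0 : 0 < Real.sqrt n := by linarith
  have hηδ : δ / Real.sqrt n ≤ δ := div_le_self hδ.le hsn
  have hLr : δ ≤ L * r := by
    rw [div_eq_iff hδ.ne'] at hexp
    rw [hexp]
    exact le_mul_of_one_le_left hδ.le (Real.one_le_exp (by linarith))
  obtain ⟨N, hNcard, hN⟩ := exists_finset_cover_range hG (η := δ / Real.sqrt n) (by positivity)
    (hηδ.trans hLr)
  have hNexp : (N.card : ℝ) ≤ Real.exp (3 * (k * Λ)) := by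
    refine hNcard.trans ?_
    have h1 : 3 * (L * r) / (δ / Real.sqrt n) = 3 * (L * r / δ) * Real.sqrt n := by field_simp
    have h2 : (3 : ℝ) ≤ Real.exp Λ := by linarith [Real.add_one_le_exp Λ]
    have h3 : Real.sqrt n ≤ Real.exp Λ := by
      rw [Real.sqrt_le_left (Real.exp_pos _).le, ← Real.exp_nat_mul]
      exact_mod_cast hnΛ
    rw [h1, hexp]
    calc (3 * Real.exp Λ * Real.sqrt n) ^ k
        ≤ (Real.exp Λ * Real.exp Λ * Real.exp Λ) ^ k := by gcongr
      _ = Real.exp (3 * (k * Λ)) := by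
        rw [← Real.exp_add, ← Real.exp_add, ← Real.exp_nat_mul]
        congr 1
        ring
  have hΛk : Λ ≤ k * Λ := le_mul_of_one_le_left (by linarith) hk1
  refine ⟨N.image (fun v => ‖v - w₀‖⁻¹ • (v - w₀)) ∪
    Finset.univ.image (fun i => EuclideanSpace.single i (1 : ℝ)), ?_, ?_, ?_⟩
  · intro u hu
    simp only [Finset.mem_union, Finset.mem_image, Finset.mem_univ, true_and] at hu
    rcases hu with ⟨v, -, rfl⟩ | ⟨i, rfl⟩
    · rw [norm_smul, norm_inv, norm_norm]
      exact inv_mul_le_one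
    · simp
  · have h1 : ((N.image (fun v => ‖v - w₀‖⁻¹ • (v - w₀)) ∪
        Finset.univ.image (fun i => EuclideanSpace.single i (1 : ℝ))).card : ℝ) ≤ N.card + n := by
      exact_mod_cast (Finset.card_union_le _ _).trans
        (add_le_add Finset.card_image_le (Finset.card_image_le.trans (by simp)))
    have h2 : (n : ℝ) ≤ Real.exp (3 * (k * Λ)) :=
      hnΛ.trans (Real.exp_le_exp.2 (by linarith))
    have h3 : 2 ≤ Real.exp (k * Λ) := by linarith [Real.add_one_le_exp (k * Λ)]
    calc _ ≤ _ := h1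
      _ ≤ 2 * Real.exp (3 * (k * Λ)) := by linarith
      _ ≤ Real.exp (k * Λ) * Real.exp (3 * (k * Λ)) := by gcongr
      _ = _ := by
        rw [← Real.exp_add]
        congr 1
        ring
  · intro b p w B hB hw hproj hU
    obtain ⟨v, hvN, hv⟩ := hN w hw
    have hD : ‖b - p‖ ≤ Real.sqrt n * B := by
      refine norm_le_sqrt_mul_of_abs_apply_le hB fun i => ?_
      have h := hU (EuclideanSpace.single i (1 : ℝ))
        (Finset.mem_union_right _ (Finset.mem_image_of_mem _ (Finset.mem_univ i)))
      simpa [EuclideanSpace.inner_single_right] using h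
    refine norm_sub_le_of_closer hB hδ.le hD hproj hv hηδ ?_ ?_
    · exact le_of_eq (by field_simp)
    · have h := hU (‖v - w₀‖⁻¹ • (v - w₀))
        (Finset.mem_union_left _ (Finset.mem_image_of_mem _ hvN))
      rcases (norm_nonneg (v - w₀)).eq_or_lt with h0 | h0
      · rw [norm_eq_zero.1 h0.symm]
        simp
      · have h1 := (abs_le.1 h).2
        rwa [real_inner_smul_right, inv_mul_le_iff₀ h0, mul_comm] at h1

/-- Contribution of an observation error `e`, bounded by Cauchy–Schwarz uniformly over `e`. -/
lemma abs_inner_backProj_le {n m : ℕ} {a : Fin m → EuclideanSpace ℝ (Fin n)} {e : Fin m → ℝ}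
    {u : EuclideanSpace ℝ (Fin n)} {K ν : ℝ} (hm : 0 < m)
    (he : 1 / Real.sqrt m * Real.sqrt (∑ i, e i ^ 2) ≤ ν)
    (hu : ∑ i, inner ℝ (a i) u ^ 2 ≤ K * m) :
    |inner ℝ (backProj a e) u| ≤ Real.sqrt K * ν := by
  have hm' : (0 : ℝ) < m := by exact_mod_cast hm
  have hs : Real.sqrt m * Real.sqrt m = m := Real.mul_self_sqrt hm'.le
  have hs0 : 0 < Real.sqrt m := Real.sqrt_pos.2 hm'
  have h1 : |∑ i, e i * inner ℝ (a i) u| ≤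
      Real.sqrt (∑ i, e i ^ 2) * Real.sqrt (∑ i, inner ℝ (a i) u ^ 2) := by
    rw [← Real.sqrt_mul (by positivity)]
    exact Real.abs_le_sqrt (Finset.sum_mul_sq_le_sq_mul_sq _ _ _)
  have h2 : Real.sqrt (∑ i, inner ℝ (a i) u ^ 2) ≤ Real.sqrt K * Real.sqrt m := by
    rw [← Real.sqrt_mul' _ hm'.le]
    exact Real.sqrt_le_sqrt hu
  have h3 : Real.sqrt (∑ i, e i ^ 2) ≤ ν * Real.sqrt m := by
    rwa [one_div_mul_eq_div, div_le_iff₀ hs0] at he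
  have h4 : inner ℝ (backProj a e) u = 1 / (m : ℝ) * ∑ i, e i * inner ℝ (a i) u := by
    simp [backProj, real_inner_smul_left, sum_inner]
  rw [h4, abs_mul, abs_of_pos (by positivity), one_div_mul_eq_div, div_le_iff₀ hm']
  calc _ ≤ _ := h1
    _ ≤ (ν * Real.sqrt m) * (Real.sqrt K * Real.sqrt m) :=
      mul_le_mul h3 h2 (Real.sqrt_nonneg _) ((Real.sqrt_nonneg _).trans h3)
    _ = Real.sqrt K * ν * (Real.sqrt m * Real.sqrt m) := by ring
    _ = _ := by rw [hs]

/-- Two independent families of independent variables form a family of independent pairs. -/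
lemma hasLaw_pi_prod {Ω α β : Type*} [MeasurableSpace Ω] [MeasurableSpace α] [MeasurableSpace β]
    {P : Measure Ω} [IsProbabilityMeasure P] {π : Measure α} {κ : Measure β}
    [IsProbabilityMeasure π] [IsProbabilityMeasure κ] {m : ℕ} {a : Fin m → Ω → α}
    {s : Fin m → Ω → β} (ha : ∀ i, HasLaw (a i) π P) (hai : iIndepFun a P)
    (hs : ∀ i, HasLaw (s i) κ P) (hsi : iIndepFun s P)
    (has : IndepFun (fun ω i => a i ω) (fun ω i => s i ω) P) :
    HasLaw (fun ω i => (a i ω, s i ω)) (Measure.pi fun _ : Fin m => π.prod κ) P :=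
  ((measurePreserving_arrowProdEquivProdArrow α β (Fin m) (fun _ => π) (fun _ => κ)).symm
    (MeasurableEquiv.arrowProdEquivProdArrow α β (Fin m))).comp_hasLaw
      (IndepFun.hasLaw_prod (hai.hasLaw_pi ha) (hsi.hasLaw_pi hs) has)

/-- The complement of a set of outer measure at most `β` contains a measurable set of measure at
least `1 - β`. -/
lemma exists_measurableSet_forall_notMem {Ω : Type*} [MeasurableSpace Ω] {P : Measure Ω}
    [IsProbabilityMeasure P] {Bad : Set Ω} {β : ℝ} (h : P.real Bad ≤ β) :
    ∃ E : Set Ω, MeasurableSet E ∧ 1 - β ≤ P.real E ∧ ∀ ω ∈ E, ω ∉ Bad := by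
  refine ⟨(toMeasurable P Bad)ᶜ, (measurableSet_toMeasurable _ _).compl, ?_,
    fun ω hω hbad => hω (subset_toMeasurable _ _ hbad)⟩
  rw [probReal_compl_eq_one_sub (measurableSet_toMeasurable _ _), measureReal_def,
    measure_toMeasurable, ← measureReal_def]
  linarith

end OneShot

end

/-! ### The recovery bound -/

theorem corollary1 (c₁ c₂ c₃ : ℝ) (hc₁ : 0 < c₁) (hc₂ : 0 < c₂) (hc₃ : 0 < c₃) :
    ∃ c C : ℝ, 0 < c ∧ 0 < C ∧
      ∀ (k n m : ℕ) (r : ℝ) (L : ℝ≥0) (δ ν : ℝ)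
        -- the generative model
        (G : OneShot.LatentBall k r → EuclideanSpace ℝ (Fin n))
        -- the random nonlinearity `f = F s`, `s ∼ κ`
        (S : Type*) [MeasurableSpace S] (κ : Measure S) [IsProbabilityMeasure κ]
        (F : S → ℝ → ℝ)
        -- the probability space, the measurement vectors `a i` and the randomness `s i` of `f i`
        (Ω : Type*) [MeasurableSpace Ω] (P : Measure Ω) [IsProbabilityMeasure P]
        (a : Fin m → Ω → EuclideanSpace ℝ (Fin n)) (s : Fin m → Ω → S)
        -- the signal, a closest point to `μ x` in the range of `G`, the observations,
        -- and the estimate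
        (x xtilde : EuclideanSpace ℝ (Fin n))
        (y : Ω → Fin m → ℝ) (xhat : Ω → EuclideanSpace ℝ (Fin n)),
        0 < r → LipschitzWith L G →
        Measurable (Function.uncurry F) →
        Integrable (fun p : S × ℝ => F p.1 p.2 ^ 4) (OneShot.jointLaw κ) →
        OneShot.meanParam F κ ≠ 0 →
        (∀ i, HasLaw (a i) (stdGaussian (EuclideanSpace ℝ (Fin n))) P) →
        iIndepFun a P →
        (∀ i, HasLaw (s i) κ P) →
        iIndepFun s P →
        IndepFun (fun ω i => a i ω) (fun ω i => s i ω) P →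
        ‖x‖ = 1 →
        0 ≤ ν →
        (∀ᵐ ω ∂P, 1 / Real.sqrt m *
          Real.sqrt (∑ i, (y ω i - F (s i ω) (inner ℝ (a i ω) x)) ^ 2) ≤ ν) →
        OneShot.IsProj G (OneShot.meanParam F κ • x) xtilde →
        (∀ᵐ ω ∂P, OneShot.IsProj G (OneShot.backProj (fun i => a i ω) (y ω)) (xhat ω)) →
        0 < δ →
        c₁ * (δ * n) ≤ L * r →
        δ ≤ c₂ * (OneShot.xi F κ * Real.sqrt (k * Real.log (L * r / δ) / m)) →
        c₃ * (k * Real.log (L * r / δ)) ≤ m →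
        ∃ E : Set Ω, MeasurableSet E ∧
          1 - Real.exp (-(c * (k * Real.log (L * r / δ))))
              - OneShot.thetaFourth F κ / (m * OneShot.xi F κ ^ 4)
              - OneShot.rhoSq F κ / (OneShot.xi F κ ^ 2 * (k * Real.log (L * r / δ)))
            ≤ P.real E ∧
          ∀ ω ∈ E, ‖xhat ω - OneShot.meanParam F κ • x‖ ≤
            C * (OneShot.xi F κ * Real.sqrt (k * Real.log (L * r / δ) / m) + ν
              + ‖xtilde - OneShot.meanParam F κ • x‖) := by
  -- `T` separates the two regimes of `log (L r / δ)`, and `K` is the constant of the chi-square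
  -- bound; with `B = 7 ε + √K ν` the bound `3 B + 4 δ + 3 τ` gives the first three terms of `C`,
  -- and the diameter bound `2 L r ≤ 2 exp(T) c₂ ε` for small `log (L r / δ)` gives the last
  set T : ℝ := max 2 |Real.log c₁|
  set K : ℝ := 2 + 28 / c₃
  have hK : 0 ≤ Real.sqrt K := Real.sqrt_nonneg K
  have heT : 0 < Real.exp T := Real.exp_pos T
  refine ⟨1, 24 + 3 * Real.sqrt K + 4 * c₂ + 2 * Real.exp T * c₂, one_pos, by positivity, ?_⟩
  intro k n m r L δ ν G S _ κ _ F Ω _ P _ a s x xtilde y xhat hr hG hF hF4 hμ ha hai hs hsi has hx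
    hν hy hxt hxh hδ hLr hδε hlm
  set Λ : ℝ := Real.log (L * r / δ)
  set ξ := OneShot.xi F κ
  set ε : ℝ := ξ * Real.sqrt (k * Λ / m)
  set p := OneShot.meanParam F κ • x
  set τ := ‖xtilde - p‖
  have hτ : 0 ≤ τ := norm_nonneg _
  -- `0 < δ ≤ c₂ ε` excludes all degenerate values of the parameters
  have hε : 0 < ε := pos_of_mul_pos_right (hδ.trans_le hδε) hc₂.le
  have hξ : 0 < ξ := pos_of_mul_pos_left hε (Real.sqrt_nonneg _)
  have hfrac : 0 < k * Λ / m := Real.sqrt_pos.1 (pos_of_mul_pos_right hε hξ.le)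
  have hm' : (0 : ℝ) < m := by
    refine (Nat.cast_nonneg m).lt_of_ne fun h => ?_
    rw [← h, div_zero] at hfrac
    exact hfrac.false
  have hm : 0 < m := by exact_mod_cast hm'
  have hl : 0 < k * Λ := by
    have := mul_pos hfrac hm'
    rwa [div_mul_cancel₀ _ hm'.ne'] at this
  have hΛ : 0 < Λ := pos_of_mul_pos_right hl (Nat.cast_nonneg k)
  have hk' : (0 : ℝ) < k := pos_of_mul_pos_left hl hΛ.le
  have hk : 0 < k := by exact_mod_cast hk'
  have hratio : 0 < L * r / δ := by
    refine (show 0 ≤ L * r / δ by positivity).lt_of_ne fun h => ?_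
    simp only [Λ] at hΛ
    rw [← h, Real.log_zero] at hΛ
    exact hΛ.false
  have hexp : L * r / δ = Real.exp Λ := (Real.exp_log hratio).symm
  have hθ : 0 ≤ OneShot.thetaFourth F κ / (m * ξ ^ 4) :=
    div_nonneg (variance_nonneg _ _) (by positivity)
  have hρ : 0 ≤ OneShot.rhoSq F κ / (ξ ^ 2 * (k * Λ)) :=
    div_nonneg (variance_nonneg _ _) (by positivity)
  -- the exceptional null set of the two almost sure hypotheses
  obtain ⟨Z, hZ, hgood⟩ : ∃ Z : Set Ω, P Z = 0 ∧ ∀ ω ∉ Z,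
      1 / Real.sqrt m * Real.sqrt (∑ i, (y ω i - F (s i ω) (inner ℝ (a i ω) x)) ^ 2) ≤ ν ∧
      OneShot.IsProj G (OneShot.backProj (fun i => a i ω) (y ω)) (xhat ω) :=
    ⟨_, ae_iff.1 (hy.and hxh), fun ω hω => not_not.1 hω⟩
  have hZ' : P.real Z = 0 := by rw [measureReal_def, hZ, ENNReal.toReal_zero]
  by_cases hΛT : Λ ≤ T
  · -- the whole range of `G` has diameter of order `δ`
    obtain ⟨E, hE, hPE, hEZ⟩ := OneShot.exists_measurableSet_forall_notMem (P := P) hZ'.le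
    refine ⟨E, hE, ?_, fun ω hω => ?_⟩
    · have := Real.exp_pos (-(1 * (k * Λ)))
      linarith
    · have h1 := OneShot.norm_sub_le_of_mem_range hG (hgood ω (hEZ ω hω)).2.1 hxt.1
      have h2 : (L : ℝ) * r ≤ Real.exp T * (c₂ * ε) := by
        rw [div_eq_iff hδ.ne'] at hexp
        rw [hexp]
        gcongr
      have h3 : ‖xhat ω - p‖ ≤ ‖xhat ω - xtilde‖ + τ := by
        rw [← sub_add_sub_cancel (xhat ω) xtilde p]
        exact norm_add_le _ _
      have h4 : 0 ≤ (24 + 3 * Real.sqrt K + 4 * c₂) * (ε + ν + τ) := by positivity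
      have h5 : 0 ≤ 2 * Real.exp T * c₂ * (ν + τ) := by positivity
      have h6 : 0 ≤ (3 * Real.sqrt K + 4 * c₂) * (ε + ν + τ) := by positivity
      nlinarith
  · have hΛT' : T ≤ Λ := (not_le.1 hΛT).le
    have hΛ2 : 2 ≤ Λ := (le_max_left _ _).trans hΛT'
    have hn : 0 < n := by
      refine Nat.pos_of_ne_zero fun h => ?_
      subst h
      rw [Subsingleton.elim x 0, norm_zero] at hx
      exact zero_ne_one hx
    have hnΛ : (n : ℝ) ≤ Real.exp (2 * Λ) := by
      have h1 : c₁ * n ≤ Real.exp Λ := by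
        rw [← hexp, le_div_iff₀ hδ]
        linarith
      have h2 : Real.exp (-Λ) ≤ c₁ := by
        rw [← Real.le_log_iff_exp_le hc₁]
        have := (le_max_right 2 |Real.log c₁|).trans hΛT'
        linarith [neg_abs_le (Real.log c₁)]
      have h3 : Real.exp (-Λ) * n ≤ Real.exp Λ :=
        (mul_le_mul_of_nonneg_right h2 (Nat.cast_nonneg n)).trans h1
      rwa [Real.exp_neg, inv_mul_le_iff₀ (Real.exp_pos _), ← Real.exp_add, ← two_mul] at h3
    have hl1 : 1 ≤ k * Λ := by
      have : (1 : ℝ) ≤ k := by exact_mod_cast hk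
      nlinarith
    obtain ⟨U, hU, hUcard, herr⟩ :=
      OneShot.exists_test_directions hG hδ hk hn hΛ2 hexp hnΛ xtilde
    obtain ⟨Bad, hBad, hdir⟩ :=
      OneShot.exists_bad_event hF hF4 hx hc₃ hl1 hm hlm hξ U hU hUcard
    have hlaw := OneShot.hasLaw_pi_prod ha hai hs hsi has
    set J : Ω → Fin m → EuclideanSpace ℝ (Fin n) × S := fun ω i => (a i ω, s i ω)
    have hJ : P.real (J ⁻¹' Bad) ≤ (Measure.pi fun _ : Fin m =>
        (stdGaussian (EuclideanSpace ℝ (Fin n))).prod κ).real Bad := by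
      refine ENNReal.toReal_mono (measure_ne_top _ _) ?_
      rw [← hlaw.map_eq]
      exact Measure.le_map_apply hlaw.aemeasurable _
    obtain ⟨E, hE, hPE, hEB⟩ := OneShot.exists_measurableSet_forall_notMem (P := P)
      ((measureReal_union_le (J ⁻¹' Bad) Z).trans (add_le_add (hJ.trans hBad) hZ'.le))
    refine ⟨E, hE, ?_, fun ω hω => ?_⟩
    · rw [one_mul]
      refine le_trans (le_of_eq ?_) hPE
      ring
    · have hω' := hEB ω hω
      simp only [Set.mem_union, not_or] at hω'
      obtain ⟨hnoise, hrange, hmin⟩ := hgood ω hω'.2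
      set q : Fin m → ℝ := fun i => F (s i ω) (inner ℝ (a i ω) x)
      have hsplit : OneShot.backProj (fun i => a i ω) (y ω) =
          OneShot.backProj (fun i => a i ω) q +
            OneShot.backProj (fun i => a i ω) (fun i => y ω i - q i) := by
        simp only [OneShot.backProj, ← smul_add, ← Finset.sum_add_distrib, ← add_smul,
          add_sub_cancel]
      have h := herr (OneShot.backProj (fun i => a i ω) (y ω)) p (xhat ω)
        (7 * ε + Real.sqrt K * ν) (by positivity) hrange (hmin _ hxt.1) fun u hu => by
          obtain ⟨h1, h2⟩ := hdir (J ω) hω'.1 u hu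
          have h3 := OneShot.abs_inner_backProj_le hm hnoise h2
          rw [hsplit, add_sub_right_comm, inner_add_left]
          exact (abs_add_le _ _).trans (add_le_add h1 h3)
      have h5 : 0 ≤ (21 + 4 * c₂) * (ν + τ) := by positivity
      have h6 : 0 ≤ (3 + 2 * Real.exp T * c₂) * (ε + ν + τ) := by positivity
      have h7 : 0 ≤ 3 * Real.sqrt K * (ε + τ) := by positivity
      nlinarith
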